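/- Let $V$ be a vertex operator algebra over $\mathbb C$ (a $\mathbb Z$-graded space with finite-dimensional homogeneous subspaces $V_n$, $V_n=0$ for $n\ll 0$), and let $M^i=\bigoplus_{n\ge 0}M^i_n$ ($i=1,2,3$) be $\mathbb N$-gradable $V$-modules, i.e. weak $V$-modules with $a_mM^i_n\subset M^i_{\mathrm{wt}(a)+n-m-1}$ for homogeneous $a\in V$. Suppose that there are $h_i\in\mathbb C$ such that $L(0)$ acts on $M^i_n$ as the scalar $h_i+n$, and that the top levels $M^2_0$ and $M^3_0$ are nonzero. For homogeneous $a\in V$ and $u\in M^1$ put $$a*u=\mathrm{Res}_z\frac{(1+z)^{\mathrm{wt}(a)}}{z}Y(a,z)u,\quad u*a=\mathrm{Res}_z\frac{(1+z)^{\mathrm{wt}(a)-1}}{z}Y(a,z)u,\quad a\circ u=\mathrm{Res}_z\frac{(1+z)^{\mathrm{wt}(a)}}{z^2}Y(a,z)u,$$ extended linearly in $a$; let $O(M^1)$ be the span of all $a\circ u$, and let $A(M^1)=M^1/O(M^1)$, with $[u]$ the class of $u$. Let $A(V)=V/O(V)$ be Zhu's algebra, where $O(V)$ is defined by the same formula with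 $V$ in place of $M^1$. It acts on $A(M^1)$ on both sides by $[a]\cdot[u]=[a*u]$ and $[u]\cdot[a]=[u*a]$, and on the top level $M^i_0$ on the left by $o(a)=a_{\mathrm{wt}(a)-1}$ (extended linearly in $a$), hence on $(M^3_0)^*$ on the right by $f\cdot[a]=f\circ o(a)$. Let $$C=(M^3_0)^*\otimes_{A(V)}A(M^1)\otimes_{A(V)}M^2_0 .$$ Let $I\binom{M^3}{M^1\ M^2}$ be the vector space of intertwining operators $I(v,z)=\sum_{n\in\mathbb C}v_nz^{-n-1}$ of type $\binom{M^3}{M^1\ M^2}$ (lower truncation $v_{n+k}u=0$ for each $n\in\mathbb C$ and all large integers $k$, the Jacobi identity, and $\frac{d}{dz}I(v,z)=I(L(-1)v,z)$), and let $N_{M^1M^2}^{M^3}$ be its dimension. For $v\in M^1_d$ put $o(v)=\mathrm{Res}_z z^{h_1+h_2-h_3+d-1}I(v,z)$, and extend $o$ linearly to $M^1$. If $M^2$ is irreducible and $M^3$ is irreducible and ordinary ($L(0)$ is semisimple with finite-dimensional eigenspaces $M^3(\lambda)$, and $M^3(\lambda+n)=0$ for each $\lambda\in\mathbb C$ and all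 sufficiently small integers $n$), then $o(v)u\in M^3_0$ for $v\in M^1$, $u\in M^2_0$, there is a well-defined linear map $$\pi: I\binom{M^3}{M^1\ M^2}\to C^*,\qquad \pi(I)(f\otimes[v]\otimes u)=\langle f,o(v)u\rangle\quad(f\in(M^3_0)^*,\ v\in M^1,\ u\in M^2_0),$$ and $\pi$ is injective. Hence $N_{M^1M^2}^{M^3}\le\dim C^*$. -/

import Mathlib

open scoped TensorProduct

noncomputable section

/-! ### Formal calculus -/

/-- The Jacobi identity
`z₀⁻¹ δ((z₁ - z₂)/z₀) A₃(z₁) J(v, z₂) u - z₀⁻¹ δ((z₂ - z₁)/(-z₀)) J(v, z₂) A₂(z₁) u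
  = z₂⁻¹ δ((z₁ - z₀)/z₂) J(A₁(z₀) v, z₂) u`
for `Aᵢ(z) = ∑ (Aᵢ)ₙ z⁻ⁿ⁻¹` (sum over the integers) and `J(v, z) = ∑ J(v)ₙ z⁻ⁿ⁻¹` (sum over `Λ`,
which is `ℤ` or `ℂ` below), written out as the equality of the coefficients of
`z₀^(-l-1) z₁^(-m-1) z₂^(-n-1)` for all `l m : ℤ` and `n : Λ`.
In all uses below the three sums have finitely many nonzero terms. -/
def JacobiIdentity {Λ U W₂ W₃ : Type*} [Ring Λ]
    [AddCommGroup U] [Module ℂ U] [AddCommGroup W₂] [Module ℂ W₂] [AddCommGroup W₃] [Module ℂ W₃]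
    (A₁ : ℤ → Module.End ℂ U) (A₂ : ℤ → Module.End ℂ W₂) (A₃ : ℤ → Module.End ℂ W₃)
    (J : U → Λ → W₂ →ₗ[ℂ] W₃) (v : U) (u : W₂) : Prop :=
  ∀ (l m : ℤ) (n : Λ),
    (∑ᶠ i : ℕ, ((-1 : ℂ) ^ i * (Ring.choose l i : ℂ)) •
        A₃ (m + l - i) (J v (n + (i : Λ)) u))
      - (∑ᶠ i : ℕ, ((-1 : ℂ) ^ l * (-1 : ℂ) ^ i * (Ring.choose l i : ℂ)) •
        J v (n + (l : Λ) - (i : Λ)) (A₂ (m + i) u))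
    = ∑ᶠ i : ℕ, (Ring.choose m i : ℂ) • J (A₁ (l + i) v) ((m : Λ) + n - (i : Λ)) u

/-- The decomposition `M ≃ ⨁ Mᵢ` of a vector space that is the internal direct sum of the `Mᵢ`. -/
def decompositionEquiv {ι M : Type*} [DecidableEq ι] [AddCommGroup M] [Module ℂ M]
    {gr : ι → Submodule ℂ M} (h : DirectSum.IsInternal gr) :
    M ≃ₗ[ℂ] DirectSum ι fun i => gr i :=
  (LinearEquiv.ofBijective (DirectSum.coeLinearMap gr)
    (show Function.Bijective (DirectSum.coeLinearMap gr) from h)).symm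

theorem decompositionEquiv_coe {ι M : Type*} [DecidableEq ι] [AddCommGroup M] [Module ℂ M]
    {gr : ι → Submodule ℂ M} (h : DirectSum.IsInternal gr) (i : ι) (x : gr i) :
    decompositionEquiv h x = DirectSum.lof ℂ ι (fun i => gr i) i x := by
  rw [decompositionEquiv, LinearEquiv.symm_apply_eq, LinearEquiv.ofBijective_apply]
  exact (DirectSum.coeLinearMap_lof gr i x).symm

/-- The linear map on `M = ⨁ Mᵢ` whose restriction to each homogeneous subspace `Mᵢ` is `f i`. -/
def linearExtension {ι M W : Type*} [DecidableEq ι] [AddCommGroup M] [Module ℂ M]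
    [AddCommGroup W] [Module ℂ W] {gr : ι → Submodule ℂ M} (h : DirectSum.IsInternal gr)
    (f : ∀ i, gr i →ₗ[ℂ] W) : M →ₗ[ℂ] W :=
  DirectSum.toModule ℂ ι W f ∘ₗ (decompositionEquiv h).toLinearMap

theorem linearExtension_apply {ι M W : Type*} [DecidableEq ι] [AddCommGroup M] [Module ℂ M]
    [AddCommGroup W] [Module ℂ W] {gr : ι → Submodule ℂ M} (h : DirectSum.IsInternal gr)
    (f : ∀ i, gr i →ₗ[ℂ] W) (i : ι) (x : gr i) : linearExtension h f x = f i x := by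
  simp [linearExtension, decompositionEquiv_coe]

/-- The projection of `M = ⨁ Mᵢ` onto the homogeneous subspace `Mᵢ`. -/
def homogeneousProj {ι M : Type*} [DecidableEq ι] [AddCommGroup M] [Module ℂ M]
    {gr : ι → Submodule ℂ M} (h : DirectSum.IsInternal gr) (i : ι) : M →ₗ[ℂ] gr i :=
  DirectSum.component ℂ ι (fun i => gr i) i ∘ₗ (decompositionEquiv h).toLinearMap

/-- For a family of fields `Y(a, z) = ∑ aₙ z⁻ⁿ⁻¹` on `M` depending linearly on `a ∈ V`,
`modeOf Y n a` is the endomorphism `aₙ`. The type `VertexOperator ℂ M` contains the condition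
`Y(a, z) u ∈ M((z))`. -/
def modeOf {V M : Type*} [AddCommGroup V] [Module ℂ V] [AddCommGroup M] [Module ℂ M]
    (Y : V →ₗ[ℂ] VertexOperator ℂ M) (n : ℤ) : V →ₗ[ℂ] Module.End ℂ M :=
  LinearMap.proj n ∘ₗ VertexOperator.ncoeff ∘ₗ Y

theorem modeOf_truncation {V M : Type*} [AddCommGroup V] [Module ℂ V] [AddCommGroup M]
    [Module ℂ M] (Y : V →ₗ[ℂ] VertexOperator ℂ M) (a : V) (u : M) :
    ∃ N : ℤ, ∀ n ≥ N, modeOf Y n a u = 0 := by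
  refine ⟨-((HahnModule.of ℂ).symm (Y a u)).order, fun n hn => ?_⟩
  exact VertexOperator.ncoeff_eq_zero_of_lt_order _ _ _ (by linarith)

theorem modeOf_support_finite {V M : Type*} [AddCommGroup V] [Module ℂ V] [AddCommGroup M]
    [Module ℂ M] (Y : V →ₗ[ℂ] VertexOperator ℂ M) (a : V) (u : M) (q : ℤ) :
    (Function.support fun i : ℕ => modeOf Y (q + i) a u).Finite := by
  obtain ⟨N, hN⟩ := modeOf_truncation Y a u
  refine (Set.finite_Iio (N - q).toNat).subset fun i hi => ?_
  by_contra h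
  exact hi (hN _ (by simp only [Set.mem_Iio, not_lt] at h; omega))

/-- `residue Y p q a u = Res_z (1 + z)ᵖ z^q Y(a, z) u = ∑_{i ≥ 0} (p choose i) a_{q+i} u`, where
`(1 + z)ᵖ` is expanded in nonnegative powers of `z`. -/
def residue {V M : Type*} [AddCommGroup V] [Module ℂ V] [AddCommGroup M] [Module ℂ M]
    (Y : V →ₗ[ℂ] VertexOperator ℂ M) (p q : ℤ) : V →ₗ[ℂ] M →ₗ[ℂ] M :=
  have hfin : ∀ (a : V) (u : M), (Function.support fun i : ℕ =>
      (Ring.choose p i : ℂ) • modeOf Y (q + i) a u).Finite := fun a u =>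
    (modeOf_support_finite Y a u q).subset fun i hi h0 => hi (by simp [h0])
  LinearMap.mk₂ ℂ
    (fun a u => ∑ᶠ i : ℕ, (Ring.choose p i : ℂ) • modeOf Y (q + i) a u)
    (fun a b u => by
      simp only [map_add, LinearMap.add_apply, smul_add]
      exact finsum_add_distrib (hfin a u) (hfin b u))
    (fun c a u => by
      simp only [map_smul, LinearMap.smul_apply, smul_comm _ c]
      exact (smul_finsum c _).symm)
    (fun a u w => by
      simp only [map_add, smul_add]
      exact finsum_add_distrib (hfin a u) (hfin a w))
    (fun c a u => by
      simp only [map_smul, smul_comm _ c]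
      exact (smul_finsum c _).symm)

/-! ### Vertex operator algebras and their modules -/

/-- A vertex operator algebra `(V, Y, 𝟏, ω)` structure on a complex vector space `V`. -/
structure VertexOperatorAlgebra (V : Type*) [AddCommGroup V] [Module ℂ V] where
  /-- The homogeneous subspaces `Vₙ`. -/
  gr : ℤ → Submodule ℂ V
  isInternal : DirectSum.IsInternal gr
  finite_gr : ∀ n, FiniteDimensional ℂ (gr n)
  gr_eq_bot : ∃ N : ℤ, ∀ n < N, gr n = ⊥
  /-- The vertex operators `Y(a, z)`, with `Y(a, z) b ∈ V((z))`. -/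
  Y : V →ₗ[ℂ] VertexOperator ℂ V
  /-- The vacuum vector. -/
  vac : V
  /-- The Virasoro element. -/
  ω : V
  vac_mem : vac ∈ gr 0
  ω_mem : ω ∈ gr 2
  jacobi : ∀ a b c : V,
    JacobiIdentity (fun n => modeOf Y n a) (fun n => modeOf Y n a) (fun n => modeOf Y n a)
      (fun b (n : ℤ) => modeOf Y n b) b c
  Y_vac : ∀ n : ℤ, modeOf Y n vac = if n = -1 then LinearMap.id else 0
  creation_regular : ∀ (a : V) (n : ℤ), 0 ≤ n → modeOf Y n a vac = 0
  creation : ∀ a : V, modeOf Y (-1) a vac = a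
  /-- The central charge. -/
  c : ℂ
  /-- The Virasoro relations for `L(n) = ω_{n+1}`. -/
  virasoro : ∀ m n : ℤ,
    modeOf Y (m + 1) ω * modeOf Y (n + 1) ω - modeOf Y (n + 1) ω * modeOf Y (m + 1) ω
      = ((m : ℂ) - n) • modeOf Y (m + n + 1) ω
        + (if m + n = 0 then ((m : ℂ) ^ 3 - m) / 12 * c else 0) • (1 : Module.End ℂ V)
  L_zero : ∀ (n : ℤ), ∀ a ∈ gr n, modeOf Y 1 ω a = (n : ℂ) • a
  /-- `Y(L(-1)a, z) = d/dz Y(a, z)`. -/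
  L_neg_one : ∀ (a : V) (n : ℤ), modeOf Y n (modeOf Y 0 ω a) = (-(n : ℂ)) • modeOf Y (n - 1) a

/-- A weak `V`-module structure on a complex vector space `M`. -/
structure WeakModule {V : Type*} [AddCommGroup V] [Module ℂ V] (𝒱 : VertexOperatorAlgebra V)
    (M : Type*) [AddCommGroup M] [Module ℂ M] where
  /-- The vertex operators `Y_M(a, z)`, with `Y_M(a, z) u ∈ M((z))`. -/
  Y : V →ₗ[ℂ] VertexOperator ℂ M
  Y_vac : ∀ n : ℤ, modeOf Y n 𝒱.vac = if n = -1 then LinearMap.id else 0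
  jacobi : ∀ (a b : V) (u : M),
    JacobiIdentity (fun n => modeOf 𝒱.Y n a) (fun n => modeOf Y n a) (fun n => modeOf Y n a)
      (fun b (n : ℤ) => modeOf Y n b) b u

namespace WeakModule

variable {V : Type*} [AddCommGroup V] [Module ℂ V] {𝒱 : VertexOperatorAlgebra V}
  {M : Type*} [AddCommGroup M] [Module ℂ M]

/-- The component operators `aₙ` of `Y_M(a, z) = ∑ aₙ z⁻ⁿ⁻¹`. -/
def mode (ℳ : WeakModule 𝒱 M) (a : V) (n : ℤ) : Module.End ℂ M := modeOf ℳ.Y n a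

/-- The operators `L(n)` of `Y_M(ω, z) = ∑ L(n) z⁻ⁿ⁻²`. -/
def L (ℳ : WeakModule 𝒱 M) (n : ℤ) : Module.End ℂ M := ℳ.mode 𝒱.ω (n + 1)

/-- `M` is nonzero and has no submodules other than `0` and `M`. -/
def IsIrreducible (ℳ : WeakModule 𝒱 M) : Prop :=
  Nontrivial M ∧ ∀ N : Submodule ℂ M,
    (∀ (a : V) (n : ℤ), ∀ u ∈ N, ℳ.mode a n u ∈ N) → N = ⊥ ∨ N = ⊤

/-- `M` is an ordinary module: `L(0)` acts semisimply with finite-dimensional eigenspaces `M(μ)`,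
and `M(μ + n) = 0` for each fixed `μ` and all sufficiently small integers `n`. -/
def IsOrdinary (ℳ : WeakModule 𝒱 M) : Prop :=
  DirectSum.IsInternal (fun μ : ℂ => Module.End.eigenspace (ℳ.L 0) μ) ∧
  (∀ μ : ℂ, FiniteDimensional ℂ (Module.End.eigenspace (ℳ.L 0) μ)) ∧
  ∀ μ : ℂ, ∃ N : ℤ, ∀ n < N, Module.End.eigenspace (ℳ.L 0) (μ + n) = ⊥

end WeakModule

/-- An `ℕ`-gradable `V`-module, together with an `ℕ`-grading `M = ⨁ Mₙ` such that
`aₘ Mₙ ⊆ M_{wt a + n - m - 1}` for homogeneous `a` (where `M_k = 0` for `k < 0`). -/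
structure NGradedModule {V : Type*} [AddCommGroup V] [Module ℂ V] (𝒱 : VertexOperatorAlgebra V)
    (M : Type*) [AddCommGroup M] [Module ℂ M] extends WeakModule 𝒱 M where
  /-- The homogeneous subspaces `Mₙ`. -/
  gr : ℕ → Submodule ℂ M
  isInternal : DirectSum.IsInternal gr
  mode_mem : ∀ (w m : ℤ) (n k : ℕ), ∀ a ∈ 𝒱.gr w, ∀ u ∈ gr n,
    w + n - m - 1 = k → toWeakModule.mode a m u ∈ gr k
  mode_eq_zero : ∀ (w m : ℤ) (n : ℕ), ∀ a ∈ 𝒱.gr w, ∀ u ∈ gr n,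
    w + n - m - 1 < 0 → toWeakModule.mode a m u = 0

/-! ### The spaces `A(M)` and the contraction -/

namespace NGradedModule

variable {V : Type*} [AddCommGroup V] [Module ℂ V] {𝒱 : VertexOperatorAlgebra V}
  {M : Type*} [AddCommGroup M] [Module ℂ M] (ℳ : NGradedModule 𝒱 M)

/-- `L(0)` acts on each `Mₙ` as the scalar `h + n`. -/
def HasLowestWeight (h : ℂ) : Prop :=
  ∀ (n : ℕ), ∀ u ∈ ℳ.gr n, ℳ.L 0 u = (h + n) • u

/-- `o(a) = a_{wt(a)-1}` for homogeneous `a ∈ V`, extended linearly to `V`. -/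
def zeroMode : V →ₗ[ℂ] Module.End ℂ M :=
  linearExtension 𝒱.isInternal fun w => modeOf ℳ.Y (w - 1) ∘ₗ (𝒱.gr w).subtype

theorem zeroMode_mem (a : V) : ∀ u ∈ ℳ.gr 0, ℳ.zeroMode a u ∈ ℳ.gr 0 := by
  intro u hu
  have ha : a ∈ ⨆ w, 𝒱.gr w := by
    rw [𝒱.isInternal.submodule_iSup_eq_top]; trivial
  induction ha using Submodule.iSup_induction' with
  | mem w x hx =>
    have : ℳ.zeroMode x = modeOf ℳ.Y (w - 1) x :=
      linearExtension_apply 𝒱.isInternal _ w ⟨x, hx⟩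
    rw [this]
    exact ℳ.mode_mem w (w - 1) 0 0 x hx u hu (by simp)
  | zero => simp
  | add x y _ _ hx hy => simpa using add_mem hx hy

/-- The action of `a ∈ V` on the top level `M₀` by `o(a)`; this is the left `A(V)`-module structure
of `M₀`. -/
def topAction (a : V) : Module.End ℂ (ℳ.gr 0) :=
  (ℳ.zeroMode a).restrict (ℳ.zeroMode_mem a)

/-- `a ∘ u = Res_z (1+z)^{wt a} z⁻² Y_M(a, z) u`. -/
def circ : V →ₗ[ℂ] M →ₗ[ℂ] M :=
  linearExtension 𝒱.isInternal fun w => residue ℳ.Y w (-2) ∘ₗ (𝒱.gr w).subtype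

/-- `a * u = Res_z (1+z)^{wt a} z⁻¹ Y_M(a, z) u`. -/
def leftStar : V →ₗ[ℂ] M →ₗ[ℂ] M :=
  linearExtension 𝒱.isInternal fun w => residue ℳ.Y w (-1) ∘ₗ (𝒱.gr w).subtype

/-- `u * a = Res_z (1+z)^{wt a - 1} z⁻¹ Y_M(a, z) u`, with the arguments in the order `a`, `u`. -/
def rightStar : V →ₗ[ℂ] M →ₗ[ℂ] M :=
  linearExtension 𝒱.isInternal fun w => residue ℳ.Y (w - 1) (-1) ∘ₗ (𝒱.gr w).subtype

/-- `O(M)`, the linear span of all `a ∘ u`. -/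
def O : Submodule ℂ M := Submodule.span ℂ {x | ∃ (a : V) (u : M), x = ℳ.circ a u}

/-- `A(M) = M / O(M)`. -/
abbrev A : Type _ := M ⧸ ℳ.O

/-- The class `[u] ∈ A(M)` of `u ∈ M`. -/
abbrev cls (u : M) : ℳ.A := ℳ.O.mkQ u

end NGradedModule

section Contraction

variable {V : Type*} [AddCommGroup V] [Module ℂ V] {𝒱 : VertexOperatorAlgebra V}
  {M₁ M₂ M₃ : Type*} [AddCommGroup M₁] [Module ℂ M₁] [AddCommGroup M₂] [Module ℂ M₂]
  [AddCommGroup M₃] [Module ℂ M₃]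
  (ℳ₁ : NGradedModule 𝒱 M₁) (ℳ₂ : NGradedModule 𝒱 M₂) (ℳ₃ : NGradedModule 𝒱 M₃)

/-- The subspace of `(M³₀)* ⊗_ℂ A(M¹) ⊗_ℂ M²₀` spanned by the relations that make the tensor product
balanced over `A(V)`, i.e. `f·[a] ⊗ [v] ⊗ u = f ⊗ [a]·[v] ⊗ u` and
`f ⊗ [v]·[a] ⊗ u = f ⊗ [v] ⊗ [a]·u` for all `[a] ∈ A(V)` (`a ∈ V`), where the actions of the class
`[a]` are `f·[a] = f ∘ o(a)`, `[a]·[v] = [a * v]`, `[v]·[a] = [v * a]` and `[a]·u = o(a)u`. -/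
def balancingRelations :
    Submodule ℂ (Module.Dual ℂ (ℳ₃.gr 0) ⊗[ℂ] (ℳ₁.A ⊗[ℂ] ℳ₂.gr 0)) :=
  Submodule.span ℂ
    ({x | ∃ (f : Module.Dual ℂ (ℳ₃.gr 0)) (a : V) (v : M₁) (u : ℳ₂.gr 0),
        x = (f ∘ₗ ℳ₃.topAction a) ⊗ₜ[ℂ] (ℳ₁.cls v ⊗ₜ[ℂ] u)
          - f ⊗ₜ[ℂ] (ℳ₁.cls (ℳ₁.leftStar a v) ⊗ₜ[ℂ] u)} ∪
     {x | ∃ (f : Module.Dual ℂ (ℳ₃.gr 0)) (a : V) (v : M₁) (u : ℳ₂.gr 0),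
        x = f ⊗ₜ[ℂ] (ℳ₁.cls (ℳ₁.rightStar a v) ⊗ₜ[ℂ] u)
          - f ⊗ₜ[ℂ] (ℳ₁.cls v ⊗ₜ[ℂ] ℳ₂.topAction a u)})

/-- The contraction `(M³₀)* ⊗_{A(V)} A(M¹) ⊗_{A(V)} M²₀`. -/
abbrev Contraction : Type _ :=
  (Module.Dual ℂ (ℳ₃.gr 0) ⊗[ℂ] (ℳ₁.A ⊗[ℂ] ℳ₂.gr 0)) ⧸ balancingRelations ℳ₁ ℳ₂ ℳ₃

/-- The element `f ⊗ [v] ⊗ u` of the contraction. -/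
def Contraction.tmul (f : Module.Dual ℂ (ℳ₃.gr 0)) (v : M₁) (u : ℳ₂.gr 0) :
    Contraction ℳ₁ ℳ₂ ℳ₃ :=
  (balancingRelations ℳ₁ ℳ₂ ℳ₃).mkQ (f ⊗ₜ[ℂ] (ℳ₁.cls v ⊗ₜ[ℂ] u))

end Contraction

/-! ### Intertwining operators -/

section Intertwining

variable {V : Type*} [AddCommGroup V] [Module ℂ V] {𝒱 : VertexOperatorAlgebra V}
  {M₁ M₂ M₃ : Type*} [AddCommGroup M₁] [Module ℂ M₁] [AddCommGroup M₂] [Module ℂ M₂]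
  [AddCommGroup M₃] [Module ℂ M₃]

/-- `I(v, z) = ∑_{n ∈ ℂ} vₙ z⁻ⁿ⁻¹`, given by the coefficients `I v n = vₙ`, is an intertwining
operator of type `(M¹, M²; M³)`. -/
structure IsIntertwining (ℳ₁ : WeakModule 𝒱 M₁) (ℳ₂ : WeakModule 𝒱 M₂) (ℳ₃ : WeakModule 𝒱 M₃)
    (I : M₁ →ₗ[ℂ] ℂ → (M₂ →ₗ[ℂ] M₃)) : Prop where
  truncation : ∀ (v : M₁) (u : M₂) (n : ℂ), ∃ K : ℤ, ∀ k : ℤ, K ≤ k → I v (n + k) u = 0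
  jacobi : ∀ (a : V) (v : M₁) (u : M₂),
    JacobiIdentity (ℳ₁.mode a) (ℳ₂.mode a) (ℳ₃.mode a) (fun v (n : ℂ) => I v n) v u
  /-- `d/dz I(v, z) = I(L(-1)v, z)`. -/
  derivative : ∀ (v : M₁) (n : ℂ), I (ℳ₁.L (-1) v) n = (-n) • I v (n - 1)

theorem IsIntertwining.finite_supports {ℳ₁ : WeakModule 𝒱 M₁} {ℳ₂ : WeakModule 𝒱 M₂}
    {ℳ₃ : WeakModule 𝒱 M₃} {I : M₁ →ₗ[ℂ] ℂ → (M₂ →ₗ[ℂ] M₃)} (hI : IsIntertwining ℳ₁ ℳ₂ ℳ₃ I)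
    (a : V) (v : M₁) (u : M₂) (l m : ℤ) (n : ℂ) (x y z : ℕ → ℂ) :
    (Function.support fun i : ℕ => x i • ℳ₃.mode a (m + l - i) (I v (n + i) u)).Finite ∧
    (Function.support fun i : ℕ => y i • I v (n + l - i) (ℳ₂.mode a (m + i) u)).Finite ∧
    (Function.support fun i : ℕ => z i • I (ℳ₁.mode a (l + i) v) (m + n - i) u).Finite := by
  refine ⟨?_, ?_, ?_⟩
  · obtain ⟨K, hK⟩ := hI.truncation v u n
    refine (Set.finite_Iio K.toNat).subset fun i hi => ?_
    by_contra h
    refine hi ?_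
    have := hK i (by simp only [Set.mem_Iio, not_lt] at h; omega)
    simp only [Int.cast_natCast] at this
    simp [this]
  · exact (modeOf_support_finite ℳ₂.Y a u m).subset fun i hi h0 =>
      hi (by simp only [WeakModule.mode, h0, map_zero, smul_zero])
  · exact (modeOf_support_finite ℳ₁.Y a v l).subset fun i hi h0 =>
      hi (by simp only [WeakModule.mode, h0, map_zero, Pi.zero_apply, LinearMap.zero_apply,
        smul_zero])

/-- The vector space of intertwining operators of type `(M¹, M²; M³)`. -/
def intertwiningOperators (ℳ₁ : WeakModule 𝒱 M₁) (ℳ₂ : WeakModule 𝒱 M₂)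
    (ℳ₃ : WeakModule 𝒱 M₃) : Submodule ℂ (M₁ →ₗ[ℂ] ℂ → (M₂ →ₗ[ℂ] M₃)) where
  carrier := {I | IsIntertwining ℳ₁ ℳ₂ ℳ₃ I}
  zero_mem' :=
    { truncation := fun v u n => ⟨0, fun k _ => by simp⟩
      jacobi := fun a v u l m n => by simp
      derivative := fun v n => by simp }
  add_mem' := fun {I J} hI hJ =>
    { truncation := fun v u n => by
        obtain ⟨K, hK⟩ := hI.truncation v u n
        obtain ⟨K', hK'⟩ := hJ.truncation v u n
        exact ⟨max K K', fun k hk => by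
          simp [hK k (le_trans (le_max_left _ _) hk), hK' k (le_trans (le_max_right _ _) hk)]⟩
      jacobi := fun a v u l m n => by
        have h1 := hI.finite_supports a v u l m n
        have h2 := hJ.finite_supports a v u l m n
        have e1 := hI.jacobi a v u l m n
        have e2 := hJ.jacobi a v u l m n
        simp only [LinearMap.add_apply, Pi.add_apply, map_add, smul_add]
        rw [finsum_add_distrib (h1 _ 0 0).1 (h2 _ 0 0).1,
          finsum_add_distrib (h1 0 _ 0).2.1 (h2 0 _ 0).2.1,
          finsum_add_distrib (h1 0 0 _).2.2 (h2 0 0 _).2.2, ← e1, ← e2]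
        abel
      derivative := fun v n => by
        simp [hI.derivative, hJ.derivative] }
  smul_mem' := fun c I hI =>
    { truncation := fun v u n => by
        obtain ⟨K, hK⟩ := hI.truncation v u n
        exact ⟨K, fun k hk => by simp [hK k hk]⟩
      jacobi := fun a v u l m n => by
        have e := hI.jacobi a v u l m n
        simp only [LinearMap.smul_apply, Pi.smul_apply, map_smul, smul_comm _ c, ← smul_finsum]
        rw [← smul_sub, e]
      derivative := fun v n => by
        simp [hI.derivative, smul_comm c] }

/-- `o(v) = Res_z z^{h₁+h₂-h₃+deg(v)-1} I(v, z)` for homogeneous `v ∈ M¹`, extended linearly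
to `M¹`. -/
def intertwiningZeroMode (ℳ₁ : NGradedModule 𝒱 M₁) (h₁ h₂ h₃ : ℂ)
    (I : M₁ →ₗ[ℂ] ℂ → (M₂ →ₗ[ℂ] M₃)) : M₁ →ₗ[ℂ] (M₂ →ₗ[ℂ] M₃) :=
  linearExtension ℳ₁.isInternal fun d =>
    LinearMap.proj (h₁ + h₂ - h₃ + (d : ℂ) - 1) ∘ₗ I ∘ₗ (ℳ₁.gr d).subtype

end Intertwining

end

open scoped TensorProduct

noncomputable section

/-! The commutator of `I` with `L(0)`, together with the derivative property, shows that for `v` of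
degree `d` and `u` of degree `k` the vector `v_n u` has `L(0)`-eigenvalue `h₁ + h₂ + d + k - n - 1`
(`L_zero_apply`). Hence it lies in one level of `M³` or is zero: `o(v)` preserves top levels, and
every `v_n` of index beyond that of `o(v)` kills `M²₀`.

For `π` to be well defined, one coefficient of the Jacobi identity expresses `o` of a residue
through the products `a_p v_n` and `v_n a_p` (`zeroMode_residue`). On `M²₀` truncation leaves at
most one term, giving `o(a ∘ v) = 0`, `o(a * v) = o(a) o(v)` and `o(v * a) = o(v) o(a)`.

For injectivity, let `o(v)u = 0` for all `v` and one nonzero `u` in `M²₀`. By the commutator formula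
no `a_m v_n u` has a component in `M³₀`. If `v_n u` were nonzero, these vectors would span the
irreducible `M³`, contradicting `M³₀ ≠ 0`. So all `v_n` kill `u`; their common kernel is a submodule
of the irreducible `M²`, hence everything. -/

@[elab_as_elim]
theorem DirectSum.IsInternal.homogeneous_induction {ι M : Type*} [DecidableEq ι] [AddCommGroup M]
    [Module ℂ M] {gr : ι → Submodule ℂ M} (h : DirectSum.IsInternal gr) {p : M → Prop}
    (mem : ∀ i, ∀ x ∈ gr i, p x) (zero : p 0) (add : ∀ x y, p x → p y → p (x + y)) (x : M) :
    p x := by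
  have hx : x ∈ ⨆ i, gr i := by
    rw [h.submodule_iSup_eq_top]; trivial
  exact Submodule.iSup_induction gr (motive := p) hx mem zero add

theorem linearExtension_of_mem {ι M W : Type*} [DecidableEq ι] [AddCommGroup M] [Module ℂ M]
    [AddCommGroup W] [Module ℂ W] {gr : ι → Submodule ℂ M} (h : DirectSum.IsInternal gr)
    (f : ∀ i, gr i →ₗ[ℂ] W) {i : ι} {x : M} (hx : x ∈ gr i) :
    linearExtension h f x = f i ⟨x, hx⟩ :=
  linearExtension_apply h f i ⟨x, hx⟩

/-! ### Components with respect to a grading. -/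

section HomogeneousProj

variable {ι M : Type*} [DecidableEq ι] [AddCommGroup M] [Module ℂ M]
  {gr : ι → Submodule ℂ M} (h : DirectSum.IsInternal gr)

theorem homogeneousProj_of_mem {i : ι} {x : M} (hx : x ∈ gr i) :
    homogeneousProj h i x = ⟨x, hx⟩ := by
  have := decompositionEquiv_coe h i ⟨x, hx⟩
  simp only at this
  simp [homogeneousProj, this, DirectSum.component.lof_self]

theorem homogeneousProj_of_mem_ne {i j : ι} (hij : i ≠ j) {x : M} (hx : x ∈ gr i) :
    homogeneousProj h j x = 0 := by
  have := decompositionEquiv_coe h i ⟨x, hx⟩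
  simp only at this
  simp [homogeneousProj, this, DirectSum.component.of, hij]

theorem eq_zero_of_homogeneousProj_eq_zero {x : M} (hx : ∀ i, homogeneousProj h i x = 0) :
    x = 0 := by
  rw [← (decompositionEquiv h).map_eq_zero_iff]
  ext i
  exact congrArg Subtype.val (hx i)

theorem mem_of_homogeneousProj_eq_zero {x : M} {j : ι}
    (hx : ∀ i, i ≠ j → homogeneousProj h i x = 0) : x ∈ gr j := by
  have : x - homogeneousProj h j x = 0 := by
    refine eq_zero_of_homogeneousProj_eq_zero h fun i => ?_
    rw [map_sub]
    by_cases hij : i = j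
    · subst hij
      rw [homogeneousProj_of_mem h (homogeneousProj h i x).2, sub_self]
    · rw [hx i hij, homogeneousProj_of_mem_ne h (Ne.symm hij) (homogeneousProj h j x).2, sub_self]
  rw [sub_eq_zero.mp this]
  exact (homogeneousProj h j x).2

end HomogeneousProj

/-! ### Cyclic submodules and `L(0)`-weights. -/

section Modules

variable {V M : Type*} [AddCommGroup V] [Module ℂ V] [AddCommGroup M] [Module ℂ M]
  {𝒱 : VertexOperatorAlgebra V}

theorem residue_apply (Y : V →ₗ[ℂ] VertexOperator ℂ M) (p q : ℤ) (a : V) (u : M) :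
    residue Y p q a u = ∑ᶠ i : ℕ, (Ring.choose p i : ℂ) • modeOf Y (q + i) a u := rfl

theorem WeakModule.mode_add (ℳ : WeakModule 𝒱 M) (a b : V) (n : ℤ) :
    ℳ.mode (a + b) n = ℳ.mode a n + ℳ.mode b n := map_add _ _ _

theorem WeakModule.mode_zero (ℳ : WeakModule 𝒱 M) (n : ℤ) : ℳ.mode 0 n = 0 := map_zero _

theorem WeakModule.mode_vac (ℳ : WeakModule 𝒱 M) (u : M) : ℳ.mode 𝒱.vac (-1) u = u := by
  simp [WeakModule.mode, ℳ.Y_vac]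

/-- The span of the vectors `aₙ u`. -/
def WeakModule.modeSpan (ℳ : WeakModule 𝒱 M) (u : M) : Submodule ℂ M :=
  Submodule.span ℂ {x | ∃ (a : V) (n : ℤ), x = ℳ.mode a n u}

theorem WeakModule.mode_mem_modeSpan (ℳ : WeakModule 𝒱 M) (a : V) (n : ℤ) (u : M) :
    ℳ.mode a n u ∈ ℳ.modeSpan u := Submodule.subset_span ⟨a, n, rfl⟩

theorem Submodule.finsum_mem {ι : Type*} (N : Submodule ℂ M) {f : ι → M} (hf : ∀ i, f i ∈ N) :
    ∑ᶠ i, f i ∈ N :=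
  finsum_induction (· ∈ N) N.zero_mem (fun _ _ => N.add_mem) hf

/-- The span of the vectors `aₙ u` is closed under all modes (weak associativity). -/
theorem WeakModule.mode_mode_mem_modeSpan (ℳ : WeakModule 𝒱 M) (a b : V) (q p : ℤ) (u : M) :
    ℳ.mode a q (ℳ.mode b p u) ∈ ℳ.modeSpan u := by
  obtain ⟨m, hm⟩ := modeOf_truncation ℳ.Y a u
  obtain ⟨N, hN⟩ := modeOf_truncation ℳ.Y b u
  -- Induction on how far `p` lies below the index `N` from which on `b_p u = 0`.
  suffices H : ∀ (k : ℕ) (p q : ℤ), N ≤ p + k → ℳ.mode a q (ℳ.mode b p u) ∈ ℳ.modeSpan u from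
    H (N - p).toNat p q (by omega)
  intro k
  induction k using Nat.strong_induction_on with
  | _ k ih =>
    intro p q hk
    by_cases hp : N ≤ p
    · rw [WeakModule.mode, WeakModule.mode, hN p hp, map_zero]
      exact zero_mem _
    -- Since `a_{m+i} u = 0` for all `i ≥ 0`, this coefficient has no `b a` terms. What remains
    -- equates `∑ ± (q-m choose i) a_{q-i} b_{p+i} u` with a combination of modes applied to `u`.
    have J := ℳ.jacobi a b u (q - m) m p
    have h2 : ∀ i : ℕ, modeOf ℳ.Y (m + i) a u = 0 := fun i => hm _ (by omega)
    simp only [h2, map_zero, smul_zero, finsum_zero, sub_zero] at J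
    push_cast at J
    have hfin : (Function.support fun i : ℕ => ((-1 : ℂ) ^ i * (Ring.choose (q - m) i : ℂ)) •
        modeOf ℳ.Y (m + (q - m) - i) a (modeOf ℳ.Y (p + (i : ℤ)) b u)).Finite :=
      (modeOf_support_finite ℳ.Y b u p).subset fun i hi h0 => hi (by simp [h0])
    have hR : (∑ᶠ i : ℕ, ((-1 : ℂ) ^ i * (Ring.choose (q - m) i : ℂ)) •
        modeOf ℳ.Y (m + (q - m) - i) a (modeOf ℳ.Y (p + (i : ℤ)) b u)) ∈ ℳ.modeSpan u := by
      rw [J]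
      exact Submodule.finsum_mem _ fun i => Submodule.smul_mem _ _ (ℳ.mode_mem_modeSpan _ _ _)
    -- The term `i = 0` is the wanted vector with coefficient 1; the others have index `p + i > p`
    -- and fall under the induction hypothesis.
    rw [← finsum_mem_univ, ← Set.union_compl_self ({0} : Set ℕ),
      finsum_mem_union' disjoint_compl_right (hfin.inter_of_right _) (hfin.inter_of_right _),
      finsum_mem_singleton] at hR
    have hS : (∑ᶠ (i : ℕ) (_ : i ∈ ({0} : Set ℕ)ᶜ), ((-1 : ℂ) ^ i * (Ring.choose (q - m) i : ℂ)) •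
        modeOf ℳ.Y (m + (q - m) - i) a (modeOf ℳ.Y (p + (i : ℤ)) b u)) ∈ ℳ.modeSpan u := by
      refine finsum_mem_induction (· ∈ ℳ.modeSpan u) (zero_mem _) (fun _ _ => add_mem)
        fun i hi => ?_
      refine Submodule.smul_mem _ _ ?_
      have hi : i ≠ 0 := hi
      exact ih (k - i) (by omega) (p + i) _ (by omega)
    have := (Submodule.add_mem_iff_left _ hS).mp hR
    simpa [WeakModule.mode] using this

theorem WeakModule.IsIrreducible.modeSpan_eq_top {ℳ : WeakModule 𝒱 M} (h : ℳ.IsIrreducible)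
    {u : M} (hu : u ≠ 0) : ℳ.modeSpan u = ⊤ := by
  refine (h.2 (ℳ.modeSpan u) fun a n x hx => ?_).resolve_left fun hbot => hu ?_
  · refine Submodule.span_le (p := (ℳ.modeSpan u).comap (ℳ.mode a n)).mpr ?_ hx
    rintro _ ⟨b, p, rfl⟩
    exact ℳ.mode_mode_mem_modeSpan a b n p u
  · have := ℳ.mode_mem_modeSpan 𝒱.vac (-1) u
    rwa [ℳ.mode_vac, hbot, Submodule.mem_bot] at this

namespace NGradedModule

variable (ℳ : NGradedModule 𝒱 M)

theorem zeroMode_of_mem {w : ℤ} {a : V} (ha : a ∈ 𝒱.gr w) : ℳ.zeroMode a = ℳ.mode a (w - 1) :=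
  linearExtension_of_mem 𝒱.isInternal _ ha

theorem circ_of_mem {w : ℤ} {a : V} (ha : a ∈ 𝒱.gr w) : ℳ.circ a = residue ℳ.Y w (-2) a :=
  linearExtension_of_mem 𝒱.isInternal _ ha

theorem leftStar_of_mem {w : ℤ} {a : V} (ha : a ∈ 𝒱.gr w) :
    ℳ.leftStar a = residue ℳ.Y w (-1) a :=
  linearExtension_of_mem 𝒱.isInternal _ ha

theorem rightStar_of_mem {w : ℤ} {a : V} (ha : a ∈ 𝒱.gr w) :
    ℳ.rightStar a = residue ℳ.Y (w - 1) (-1) a :=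
  linearExtension_of_mem 𝒱.isInternal _ ha

variable {ℳ}

theorem HasLowestWeight.homogeneousProj_L_zero {h : ℂ} (hM : ℳ.HasLowestWeight h) (i : ℕ) (x : M) :
    homogeneousProj ℳ.isInternal i (ℳ.L 0 x) = (h + i) • homogeneousProj ℳ.isInternal i x := by
  refine ℳ.isInternal.homogeneous_induction (fun j y hy => ?_) (by simp)
    (fun y z hy hz => by rw [map_add, map_add, map_add, hy, hz, smul_add]) x
  rw [hM j y hy, map_smul]
  by_cases hij : j = i
  · rw [hij]
  · rw [homogeneousProj_of_mem_ne _ hij hy, smul_zero, smul_zero]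

/-- Different levels carry different scalars `h + i`, so an `L(0)`-eigenvector has a component in at
most one level. This turns eigenvalue computations into statements about degree. -/
theorem HasLowestWeight.homogeneousProj_eq_zero {h : ℂ} (hM : ℳ.HasLowestWeight h) {x : M} {μ : ℂ}
    (hx : ℳ.L 0 x = μ • x) {i : ℕ} (hi : μ ≠ h + i) : homogeneousProj ℳ.isInternal i x = 0 := by
  have := hM.homogeneousProj_L_zero i x
  rw [hx, map_smul, ← sub_eq_zero, ← sub_smul, smul_eq_zero] at this
  exact this.resolve_left (sub_ne_zero.mpr hi)

end NGradedModule

end Modules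

/-! ### Weights and zero modes of intertwining operators. -/

section Intertwining

variable {V : Type*} [AddCommGroup V] [Module ℂ V] {𝒱 : VertexOperatorAlgebra V}
  {M₁ M₂ M₃ : Type*} [AddCommGroup M₁] [Module ℂ M₁] [AddCommGroup M₂] [Module ℂ M₂]
  [AddCommGroup M₃] [Module ℂ M₃]

/-- This is the Jacobi identity at `l = 0`, where the binomials `(0 choose i)` leave one term in
each sum on the left. -/
theorem IsIntertwining.commutator {ℳ₁ : WeakModule 𝒱 M₁} {ℳ₂ : WeakModule 𝒱 M₂}
    {ℳ₃ : WeakModule 𝒱 M₃} {I : M₁ →ₗ[ℂ] ℂ → (M₂ →ₗ[ℂ] M₃)} (hI : IsIntertwining ℳ₁ ℳ₂ ℳ₃ I)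
    (a : V) (v : M₁) (u : M₂) (m : ℤ) (n : ℂ) :
    ℳ₃.mode a m (I v n u) - I v n (ℳ₂.mode a m u) =
      ∑ᶠ i : ℕ, (Ring.choose m i : ℂ) • I (ℳ₁.mode a i v) (m + n - i) u := by
  have J := hI.jacobi a v u 0 m n
  rw [finsum_eq_single _ 0, finsum_eq_single _ 0] at J
  · simpa using J
  · intro i hi
    simp [Ring.choose_zero_pos ℂ (Nat.pos_of_ne_zero hi)]
  · intro i hi
    simp [Ring.choose_zero_pos ℂ (Nat.pos_of_ne_zero hi)]

variable {ℳ₁ : NGradedModule 𝒱 M₁} {ℳ₂ : NGradedModule 𝒱 M₂} {ℳ₃ : NGradedModule 𝒱 M₃}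
  {h₁ h₂ h₃ : ℂ} {I : M₁ →ₗ[ℂ] ℂ → (M₂ →ₗ[ℂ] M₃)}

theorem intertwiningZeroMode_of_mem {d : ℕ} {v : M₁} (hv : v ∈ ℳ₁.gr d) :
    intertwiningZeroMode ℳ₁ h₁ h₂ h₃ I v = I v (h₁ + h₂ - h₃ + d - 1) :=
  linearExtension_of_mem ℳ₁.isInternal _ hv

namespace IsIntertwining

theorem L_zero_apply (hM₁ : ℳ₁.HasLowestWeight h₁) (hM₂ : ℳ₂.HasLowestWeight h₂)
    (hI : IsIntertwining ℳ₁.toWeakModule ℳ₂.toWeakModule ℳ₃.toWeakModule I)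
    {d k : ℕ} {v : M₁} {u : M₂} (hv : v ∈ ℳ₁.gr d) (hu : u ∈ ℳ₂.gr k) (n : ℂ) :
    ℳ₃.L 0 (I v n u) = (h₁ + h₂ + d + k - n - 1) • I v n u := by
  have C := hI.commutator 𝒱.ω v u 1 n
  -- With `m = 1` only `i = 0, 1` survive, namely `(L(-1)v)_{n+1} u = -(n+1) v_n u` and `(L(0)v)_n u
  -- = (h₁ + d) v_n u`.
  rw [finsum_eq_finsetSum_of_support_subset (s := Finset.range 2)] at C
  · have h0 := hM₁ d v hv
    have h1 := hI.derivative v (n + 1)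
    have h2 := hM₂ k u hu
    simp only [WeakModule.L, zero_add, neg_add_cancel] at h0 h1 h2
    simp only [Finset.sum_range_succ, Finset.sum_range_zero, zero_add, h2,
      Ring.choose_zero_right, Ring.choose_one_right, Nat.cast_zero, Nat.cast_one, Int.cast_one,
      one_smul, sub_zero, add_comm (1 : ℂ) n, add_sub_cancel_right, h0, h1, map_smul,
      LinearMap.smul_apply, Pi.smul_apply] at C
    rw [sub_eq_iff_eq_add] at C
    simp only [WeakModule.L, zero_add]
    rw [C]
    module
  · intro i hi
    by_contra h
    refine hi ?_
    have : Ring.choose (1 : ℂ) i = 0 := by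
      have := Ring.choose_natCast (R := ℂ) 1 i
      rw [Nat.cast_one] at this
      rw [this, Nat.choose_eq_zero_of_lt, Nat.cast_zero]
      simp at h; omega
    simp [this]

theorem apply_mem (hM₁ : ℳ₁.HasLowestWeight h₁) (hM₂ : ℳ₂.HasLowestWeight h₂)
    (hM₃ : ℳ₃.HasLowestWeight h₃)
    (hI : IsIntertwining ℳ₁.toWeakModule ℳ₂.toWeakModule ℳ₃.toWeakModule I)
    {d k j : ℕ} {v : M₁} {u : M₂} (hv : v ∈ ℳ₁.gr d) (hu : u ∈ ℳ₂.gr k) {n : ℂ}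
    (hn : n = h₁ + h₂ - h₃ + d + k - 1 - j) : I v n u ∈ ℳ₃.gr j := by
  refine mem_of_homogeneousProj_eq_zero ℳ₃.isInternal fun i hi =>
    hM₃.homogeneousProj_eq_zero (hI.L_zero_apply hM₁ hM₂ hv hu n) fun h => hi ?_
  have : (j : ℂ) = i := by linear_combination h + hn
  exact_mod_cast this.symm

theorem apply_eq_zero (hM₁ : ℳ₁.HasLowestWeight h₁) (hM₂ : ℳ₂.HasLowestWeight h₂)
    (hM₃ : ℳ₃.HasLowestWeight h₃)
    (hI : IsIntertwining ℳ₁.toWeakModule ℳ₂.toWeakModule ℳ₃.toWeakModule I)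
    {d k : ℕ} {v : M₁} {u : M₂} (hv : v ∈ ℳ₁.gr d) (hu : u ∈ ℳ₂.gr k) {n : ℂ}
    (hn : ∀ j : ℕ, n ≠ h₁ + h₂ - h₃ + d + k - 1 - j) : I v n u = 0 := by
  refine eq_zero_of_homogeneousProj_eq_zero ℳ₃.isInternal fun i =>
    hM₃.homogeneousProj_eq_zero (hI.L_zero_apply hM₁ hM₂ hv hu n) fun h => hn i ?_
  linear_combination -h

/-- Modes raising the index beyond that of `o(v)` kill the top level. -/
theorem apply_top_eq_zero (hM₁ : ℳ₁.HasLowestWeight h₁) (hM₂ : ℳ₂.HasLowestWeight h₂)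
    (hM₃ : ℳ₃.HasLowestWeight h₃)
    (hI : IsIntertwining ℳ₁.toWeakModule ℳ₂.toWeakModule ℳ₃.toWeakModule I)
    {d : ℕ} {v : M₁} {u : M₂} (hv : v ∈ ℳ₁.gr d) (hu : u ∈ ℳ₂.gr 0) {n : ℂ} (i : ℕ)
    (hn : n = h₁ + h₂ - h₃ + d + i) : I v n u = 0 := by
  refine hI.apply_eq_zero hM₁ hM₂ hM₃ hv hu fun j hj => ?_
  have : ((i + j + 1 : ℕ) : ℂ) = 0 := by
    push_cast
    push_cast at hj
    linear_combination hj - hn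
  exact absurd (Nat.cast_eq_zero.mp this) (by omega)

theorem zeroMode_mem (hM₁ : ℳ₁.HasLowestWeight h₁) (hM₂ : ℳ₂.HasLowestWeight h₂)
    (hM₃ : ℳ₃.HasLowestWeight h₃)
    (hI : IsIntertwining ℳ₁.toWeakModule ℳ₂.toWeakModule ℳ₃.toWeakModule I)
    (v : M₁) {u : M₂} (hu : u ∈ ℳ₂.gr 0) :
    intertwiningZeroMode ℳ₁ h₁ h₂ h₃ I v u ∈ ℳ₃.gr 0 := by
  refine ℳ₁.isInternal.homogeneous_induction (fun d x hx => ?_) (by simp)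
    (fun x y hx hy => by simpa using add_mem hx hy) v
  rw [intertwiningZeroMode_of_mem hx]
  exact hI.apply_mem hM₁ hM₂ hM₃ hx hu (by simp)

/-- The degree `w + d - m - 1` stays an integer: when it is negative, `a_m v = 0` and both sides
vanish, so later sums need no case distinction. -/
theorem zeroMode_mode {w : ℤ} {a : V} (ha : a ∈ 𝒱.gr w) {d : ℕ} {v : M₁} (hv : v ∈ ℳ₁.gr d)
    (m : ℤ) : intertwiningZeroMode ℳ₁ h₁ h₂ h₃ I (ℳ₁.mode a m v) =
      I (ℳ₁.mode a m v) (h₁ + h₂ - h₃ + (w + d - m - 1 : ℤ) - 1) := by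
  by_cases hk : w + d - m - 1 < 0
  · rw [ℳ₁.mode_eq_zero w m d a ha v hv hk, map_zero, map_zero, Pi.zero_apply]
  · obtain ⟨k, hk⟩ := Int.eq_ofNat_of_zero_le (not_lt.mp hk)
    rw [intertwiningZeroMode_of_mem (ℳ₁.mode_mem w m d k a ha v hv hk), hk, Int.cast_natCast]

/-- The value of `n` makes `p + n - i` the zero-mode index of `a_{q+i} v` for every `i`, so the
residue is the right-hand side of the Jacobi identity at `l = q`, `m = p`. -/
theorem zeroMode_residue {w : ℤ} {a : V} (ha : a ∈ 𝒱.gr w) {d : ℕ} {v : M₁} (hv : v ∈ ℳ₁.gr d)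
    (hI : IsIntertwining ℳ₁.toWeakModule ℳ₂.toWeakModule ℳ₃.toWeakModule I)
    (p q : ℤ) (u : M₂) {n : ℂ} (hn : n = h₁ + h₂ - h₃ + w + d - p - q - 2) :
    intertwiningZeroMode ℳ₁ h₁ h₂ h₃ I (residue ℳ₁.Y p q a v) u =
      (∑ᶠ i : ℕ, ((-1 : ℂ) ^ i * (Ring.choose q i : ℂ)) •
        ℳ₃.mode a (p + q - i) (I v (n + i) u))
      - ∑ᶠ i : ℕ, ((-1 : ℂ) ^ q * (-1 : ℂ) ^ i * (Ring.choose q i : ℂ)) •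
        I v (n + q - i) (ℳ₂.mode a (p + i) u) := by
  have J := hI.jacobi a v u q p n
  beta_reduce at J
  have hfin : (Function.support fun i : ℕ =>
      (Ring.choose p i : ℂ) • modeOf ℳ₁.Y (q + i) a v).Finite :=
    (modeOf_support_finite ℳ₁.Y a v q).subset fun i hi h0 => hi (by simp [h0])
  rw [J, residue_apply, ← LinearMap.flip_apply, map_finsum _ hfin]
  refine finsum_congr fun i => ?_
  rw [map_smul, LinearMap.flip_apply]
  have e : (p : ℂ) + n - i = h₁ + h₂ - h₃ + (w + d - (q + i) - 1 : ℤ) - 1 := by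
    rw [hn]; push_cast; ring
  rw [e]
  exact congrArg (fun T : M₂ →ₗ[ℂ] M₃ => (Ring.choose p i : ℂ) • T u) (zeroMode_mode ha hv (q + i))

end IsIntertwining
end Intertwining

/-! ### Compatibility of zero modes with `O(M¹)` and the two actions of `A(V)`. -/

section Intertwining

variable {V : Type*} [AddCommGroup V] [Module ℂ V] {𝒱 : VertexOperatorAlgebra V}
  {M₁ M₂ M₃ : Type*} [AddCommGroup M₁] [Module ℂ M₁] [AddCommGroup M₂] [Module ℂ M₂]
  [AddCommGroup M₃] [Module ℂ M₃]
  {ℳ₁ : NGradedModule 𝒱 M₁} {ℳ₂ : NGradedModule 𝒱 M₂} {ℳ₃ : NGradedModule 𝒱 M₃}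
  {h₁ h₂ h₃ : ℂ} {I : M₁ →ₗ[ℂ] ℂ → (M₂ →ₗ[ℂ] M₃)}

theorem NGradedModule.mode_top_eq_zero {w m : ℤ} {a : V} (ha : a ∈ 𝒱.gr w) {u : M₂}
    (hu : u ∈ ℳ₂.gr 0) (hm : w ≤ m) : ℳ₂.mode a m u = 0 :=
  ℳ₂.mode_eq_zero w m 0 a ha u hu (by push_cast; omega)

namespace IsIntertwining

theorem zeroMode_circ (hM₁ : ℳ₁.HasLowestWeight h₁) (hM₂ : ℳ₂.HasLowestWeight h₂)
    (hM₃ : ℳ₃.HasLowestWeight h₃)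
    (hI : IsIntertwining ℳ₁.toWeakModule ℳ₂.toWeakModule ℳ₃.toWeakModule I)
    (a : V) (v : M₁) {u : M₂} (hu : u ∈ ℳ₂.gr 0) :
    intertwiningZeroMode ℳ₁ h₁ h₂ h₃ I (ℳ₁.circ a v) u = 0 := by
  refine 𝒱.isInternal.homogeneous_induction (fun w a ha => ?_) (by simp)
    (fun a b ha hb => by simp [ha, hb]) a
  refine ℳ₁.isInternal.homogeneous_induction (fun d v hv => ?_) (by simp)
    (fun x y hx hy => by simp [hx, hy]) v
  rw [ℳ₁.circ_of_mem ha, zeroMode_residue (n := h₁ + h₂ - h₃ + d) ha hv hI _ _ _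
    (by push_cast; ring), finsum_eq_zero_of_forall_eq_zero, finsum_eq_zero_of_forall_eq_zero,
    sub_zero]
  · intro i
    rw [NGradedModule.mode_top_eq_zero ha hu (by omega), map_zero, smul_zero]
  · intro i
    rw [hI.apply_top_eq_zero hM₁ hM₂ hM₃ hv hu i rfl, map_zero, smul_zero]

theorem zeroMode_leftStar (hM₁ : ℳ₁.HasLowestWeight h₁) (hM₂ : ℳ₂.HasLowestWeight h₂)
    (hM₃ : ℳ₃.HasLowestWeight h₃)
    (hI : IsIntertwining ℳ₁.toWeakModule ℳ₂.toWeakModule ℳ₃.toWeakModule I)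
    (a : V) (v : M₁) {u : M₂} (hu : u ∈ ℳ₂.gr 0) :
    intertwiningZeroMode ℳ₁ h₁ h₂ h₃ I (ℳ₁.leftStar a v) u =
      ℳ₃.zeroMode a (intertwiningZeroMode ℳ₁ h₁ h₂ h₃ I v u) := by
  refine 𝒱.isInternal.homogeneous_induction (fun w a ha => ?_) (by simp)
    (fun a b ha hb => by simp [ha, hb]) a
  refine ℳ₁.isInternal.homogeneous_induction (fun d v hv => ?_) (by simp)
    (fun x y hx hy => by simp [hx, hy]) v
  rw [ℳ₁.leftStar_of_mem ha, zeroMode_residue (n := h₁ + h₂ - h₃ + d - 1) ha hv hI _ _ _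
    (by push_cast; ring), finsum_eq_single _ 0, finsum_eq_zero_of_forall_eq_zero, sub_zero,
    ℳ₃.zeroMode_of_mem ha, intertwiningZeroMode_of_mem hv]
  · simp [sub_eq_add_neg]
  · intro i
    rw [NGradedModule.mode_top_eq_zero ha hu (by omega), map_zero, smul_zero]
  -- Here `n` is the index of `o(v)` itself, so only the terms `i ≥ 1` vanish; `i = 0` gives `o(a)
  -- o(v) u`.
  · intro i hi
    obtain ⟨i, rfl⟩ := Nat.exists_eq_succ_of_ne_zero hi
    rw [hI.apply_top_eq_zero hM₁ hM₂ hM₃ hv hu i (by push_cast; ring), map_zero, smul_zero]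

theorem zeroMode_rightStar (hM₁ : ℳ₁.HasLowestWeight h₁) (hM₂ : ℳ₂.HasLowestWeight h₂)
    (hM₃ : ℳ₃.HasLowestWeight h₃)
    (hI : IsIntertwining ℳ₁.toWeakModule ℳ₂.toWeakModule ℳ₃.toWeakModule I)
    (a : V) (v : M₁) {u : M₂} (hu : u ∈ ℳ₂.gr 0) :
    intertwiningZeroMode ℳ₁ h₁ h₂ h₃ I (ℳ₁.rightStar a v) u =
      intertwiningZeroMode ℳ₁ h₁ h₂ h₃ I v (ℳ₂.zeroMode a u) := by
  refine 𝒱.isInternal.homogeneous_induction (fun w a ha => ?_) (by simp)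
    (fun a b ha hb => by simp [ha, hb]) a
  refine ℳ₁.isInternal.homogeneous_induction (fun d v hv => ?_) (by simp)
    (fun x y hx hy => by simp [hx, hy]) v
  rw [ℳ₁.rightStar_of_mem ha, zeroMode_residue (n := h₁ + h₂ - h₃ + d) ha hv hI _ _ _
    (by push_cast; ring), finsum_eq_zero_of_forall_eq_zero, finsum_eq_single _ 0, zero_sub,
    ℳ₂.zeroMode_of_mem ha, intertwiningZeroMode_of_mem hv]
  -- The sign `(-1)^q` at `q = -1` cancels the minus sign in front of the second sum.
  · simp [sub_eq_add_neg]
  · intro i hi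
    rw [NGradedModule.mode_top_eq_zero ha hu (by omega), map_zero, smul_zero]
  · intro i
    rw [hI.apply_top_eq_zero hM₁ hM₂ hM₃ hv hu i rfl, map_zero, smul_zero]

/-! ### Vanishing zero modes force the operator to vanish. -/

/-- If the zero modes `o(v)` vanish on the top level of `M²`, then the vectors `aₘ I(v)ₙ u` with
`u` in the top level have no component in the top level of `M³`. -/
theorem homogeneousProj_mode_apply (hM₁ : ℳ₁.HasLowestWeight h₁) (hM₂ : ℳ₂.HasLowestWeight h₂)
    (hM₃ : ℳ₃.HasLowestWeight h₃)
    (hI : IsIntertwining ℳ₁.toWeakModule ℳ₂.toWeakModule ℳ₃.toWeakModule I) {u : M₂}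
    (hu : u ∈ ℳ₂.gr 0) (ho : ∀ v : M₁, intertwiningZeroMode ℳ₁ h₁ h₂ h₃ I v u = 0)
    (a : V) (m : ℤ) {d : ℕ} {v : M₁} (hv : v ∈ ℳ₁.gr d) (n : ℂ) :
    homogeneousProj ℳ₃.isInternal 0 (ℳ₃.mode a m (I v n u)) = 0 := by
  by_cases hn : ∀ j : ℕ, n ≠ h₁ + h₂ - h₃ + d + (0 : ℕ) - 1 - j
  · rw [hI.apply_eq_zero hM₁ hM₂ hM₃ hv hu hn, map_zero, map_zero]
  push Not at hn
  obtain ⟨j, hn⟩ := hn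
  have hmem := hI.apply_mem hM₁ hM₂ hM₃ hv hu hn
  refine 𝒱.isInternal.homogeneous_induction (fun w a ha => ?_) (by simp [WeakModule.mode_zero])
    (fun a b ha hb => by simp [WeakModule.mode_add, ha, hb]) a
  -- The integer compared with 0 is the degree of `a_m v_n u`; only degree 0 can contribute to the
  -- top level.
  rcases lt_trichotomy (w + j - m - 1) 0 with h | h | h
  · rw [ℳ₃.mode_eq_zero w m j a ha _ hmem h, map_zero]
  · suffices ℳ₃.mode a m (I v n u) = 0 by rw [this, map_zero]
    obtain rfl | hj := Nat.eq_zero_or_pos j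
    · have := ho v
      rw [intertwiningZeroMode_of_mem hv] at this
      rw [hn, Nat.cast_zero, add_zero, sub_zero, this, map_zero]
    -- Now `j > 0` forces `m = w + j - 1 ≥ w`, so `a_m u = 0`, and the commutator is a combination
    -- of vectors `o(a_i v) u`.
    have C := hI.commutator a v u m n
    rw [NGradedModule.mode_top_eq_zero ha hu (by omega), map_zero, sub_zero] at C
    rw [C]
    refine finsum_eq_zero_of_forall_eq_zero fun i => ?_
    have hi := ho (ℳ₁.mode a i v)
    rw [zeroMode_mode ha hv i] at hi
    have e : (m : ℂ) + n - i = h₁ + h₂ - h₃ + (w + d - i - 1 : ℤ) - 1 := by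
      have : (w : ℂ) + j - m - 1 = 0 := by exact_mod_cast h
      push_cast at hn ⊢
      linear_combination hn - this
    rw [e, hi, smul_zero]
  · obtain ⟨k, hk⟩ := Int.eq_ofNat_of_zero_le h.le
    exact homogeneousProj_of_mem_ne _ (by omega) (ℳ₃.mode_mem w m j k a ha _ hmem hk)

theorem apply_top_eq_zero_of_zeroMode (hM₁ : ℳ₁.HasLowestWeight h₁)
    (hM₂ : ℳ₂.HasLowestWeight h₂) (hM₃ : ℳ₃.HasLowestWeight h₃) (htop₃ : ℳ₃.gr 0 ≠ ⊥)
    (hirr₃ : ℳ₃.IsIrreducible)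
    (hI : IsIntertwining ℳ₁.toWeakModule ℳ₂.toWeakModule ℳ₃.toWeakModule I) {u : M₂}
    (hu : u ∈ ℳ₂.gr 0) (ho : ∀ v : M₁, intertwiningZeroMode ℳ₁ h₁ h₂ h₃ I v u = 0)
    (v : M₁) (n : ℂ) : I v n u = 0 := by
  refine ℳ₁.isInternal.homogeneous_induction (fun d v hv => ?_) (by simp)
    (fun x y hx hy => by simp [hx, hy]) v
  by_contra hw
  have htop := hirr₃.modeSpan_eq_top hw
  obtain ⟨y, hy, hy0⟩ := Submodule.exists_mem_ne_zero_of_ne_bot htop₃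
  have hspan : y ∈ ℳ₃.modeSpan (I v n u) := htop ▸ Submodule.mem_top
  have hle : ℳ₃.modeSpan (I v n u) ≤ LinearMap.ker (homogeneousProj ℳ₃.isInternal 0) := by
    refine Submodule.span_le.mpr ?_
    rintro _ ⟨a, m, rfl⟩
    exact hI.homogeneousProj_mode_apply hM₁ hM₂ hM₃ hu ho a m hv n
  have := hle hspan
  rw [LinearMap.mem_ker, homogeneousProj_of_mem _ hy] at this
  exact hy0 (congrArg Subtype.val this)

/-- By the commutator formula the common kernel of all `v_n` is a submodule of `M²`; it contains `u
≠ 0`. -/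
theorem eq_zero_of_apply_eq_zero {ℳ₁ : WeakModule 𝒱 M₁} {ℳ₂ : WeakModule 𝒱 M₂}
    {ℳ₃ : WeakModule 𝒱 M₃} (hirr₂ : ℳ₂.IsIrreducible) (hI : IsIntertwining ℳ₁ ℳ₂ ℳ₃ I) {u : M₂}
    (hu : u ≠ 0) (h : ∀ v n, I v n u = 0) : I = 0 := by
  let N : Submodule ℂ M₂ := ⨅ (v : M₁) (n : ℂ), LinearMap.ker (I v n)
  have hN : ∀ x, x ∈ N ↔ ∀ v n, I v n x = 0 := by simp [N]
  have htop : N = ⊤ := by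
    refine (hirr₂.2 N fun a m x hx => ?_).resolve_left fun hbot => hu ?_
    · rw [hN] at hx ⊢
      intro v n
      have C := hI.commutator a v x m n
      simpa only [hx, map_zero, smul_zero, finsum_zero, zero_sub, neg_eq_zero] using C
    · rw [← Submodule.mem_bot ℂ, ← hbot, hN]
      exact h
  ext v n x
  exact (hN x).mp (htop ▸ Submodule.mem_top) v n

theorem eq_zero_of_zeroMode_eq_zero (hM₁ : ℳ₁.HasLowestWeight h₁)
    (hM₂ : ℳ₂.HasLowestWeight h₂) (hM₃ : ℳ₃.HasLowestWeight h₃) (htop₂ : ℳ₂.gr 0 ≠ ⊥)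
    (htop₃ : ℳ₃.gr 0 ≠ ⊥) (hirr₂ : ℳ₂.IsIrreducible) (hirr₃ : ℳ₃.IsIrreducible)
    (hI : IsIntertwining ℳ₁.toWeakModule ℳ₂.toWeakModule ℳ₃.toWeakModule I)
    (ho : ∀ v : M₁, ∀ u ∈ ℳ₂.gr 0, intertwiningZeroMode ℳ₁ h₁ h₂ h₃ I v u = 0) : I = 0 := by
  obtain ⟨u, hu, hu0⟩ := Submodule.exists_mem_ne_zero_of_ne_bot htop₂
  exact hI.eq_zero_of_apply_eq_zero hirr₂ hu0 fun v n =>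
    hI.apply_top_eq_zero_of_zeroMode hM₁ hM₂ hM₃ htop₃ hirr₃ hu (fun v => ho v u hu) v n

end IsIntertwining

/-! ### The map `π` and its injectivity. -/

variable (ℳ₁ ℳ₂ ℳ₃ h₁ h₂ h₃) in
/-- The bilinear map `(v, u) ↦ o(v)u` from `M¹ × M²₀` to `M³₀`, linear in `I`. -/
def topPairing : (M₁ →ₗ[ℂ] ℂ → (M₂ →ₗ[ℂ] M₃)) →ₗ[ℂ] M₁ →ₗ[ℂ] ℳ₂.gr 0 →ₗ[ℂ] ℳ₃.gr 0 where
  -- Projecting to `M³₀` makes the map defined and linear on all families `I`; on intertwining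
  -- operators the projection changes nothing (`coe_topPairing`).
  toFun I := (LinearMap.compRight ℂ (homogeneousProj ℳ₃.isInternal 0) ∘ₗ
    LinearMap.lcomp ℂ M₃ (ℳ₂.gr 0).subtype) ∘ₗ intertwiningZeroMode ℳ₁ h₁ h₂ h₃ I
  map_add' I J := by
    ext v : 1
    refine ℳ₁.isInternal.homogeneous_induction (fun d v hv => ?_) (by simp)
      (fun x y hx hy => by rw [map_add, hx, hy, map_add]) v
    simp [intertwiningZeroMode_of_mem hv, LinearMap.comp_add]
  map_smul' c I := by
    ext v : 1
    refine ℳ₁.isInternal.homogeneous_induction (fun d v hv => ?_) (by simp)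
      (fun x y hx hy => by rw [map_add, hx, hy, map_add]) v
    simp [intertwiningZeroMode_of_mem hv]

theorem topPairing_apply (v : M₁) (u : ℳ₂.gr 0) :
    topPairing ℳ₁ ℳ₂ ℳ₃ h₁ h₂ h₃ I v u =
      homogeneousProj ℳ₃.isInternal 0 (intertwiningZeroMode ℳ₁ h₁ h₂ h₃ I v u) := rfl

namespace IsIntertwining

theorem coe_topPairing (hM₁ : ℳ₁.HasLowestWeight h₁) (hM₂ : ℳ₂.HasLowestWeight h₂)
    (hM₃ : ℳ₃.HasLowestWeight h₃)
    (hI : IsIntertwining ℳ₁.toWeakModule ℳ₂.toWeakModule ℳ₃.toWeakModule I)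
    (v : M₁) (u : ℳ₂.gr 0) :
    (topPairing ℳ₁ ℳ₂ ℳ₃ h₁ h₂ h₃ I v u : M₃) = intertwiningZeroMode ℳ₁ h₁ h₂ h₃ I v u := by
  rw [topPairing_apply, homogeneousProj_of_mem _ (hI.zeroMode_mem hM₁ hM₂ hM₃ v u.2)]

theorem O_le_ker_topPairing (hM₁ : ℳ₁.HasLowestWeight h₁) (hM₂ : ℳ₂.HasLowestWeight h₂)
    (hM₃ : ℳ₃.HasLowestWeight h₃)
    (hI : IsIntertwining ℳ₁.toWeakModule ℳ₂.toWeakModule ℳ₃.toWeakModule I) :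
    ℳ₁.O ≤ LinearMap.ker (topPairing ℳ₁ ℳ₂ ℳ₃ h₁ h₂ h₃ I) := by
  refine Submodule.span_le.mpr ?_
  rintro _ ⟨a, v, rfl⟩
  refine LinearMap.ext fun u => ?_
  rw [topPairing_apply, hI.zeroMode_circ hM₁ hM₂ hM₃ a v u.2, map_zero, LinearMap.zero_apply]

/-- The functional `f ⊗ [v] ⊗ u ↦ ⟨f, o(v)u⟩` on the contraction. -/
def contractionFunctional (hM₁ : ℳ₁.HasLowestWeight h₁) (hM₂ : ℳ₂.HasLowestWeight h₂)
    (hM₃ : ℳ₃.HasLowestWeight h₃)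
    (hI : IsIntertwining ℳ₁.toWeakModule ℳ₂.toWeakModule ℳ₃.toWeakModule I) :
    Module.Dual ℂ (Contraction ℳ₁ ℳ₂ ℳ₃) :=
  (balancingRelations ℳ₁ ℳ₂ ℳ₃).liftQ
    (contractLeft ℂ (ℳ₃.gr 0) ∘ₗ LinearMap.lTensor _ (TensorProduct.lift
      (ℳ₁.O.liftQ (topPairing ℳ₁ ℳ₂ ℳ₃ h₁ h₂ h₃ I) (hI.O_le_ker_topPairing hM₁ hM₂ hM₃)))) <| by
    refine Submodule.span_le.mpr ?_
    rintro _ (⟨f, a, v, u, rfl⟩ | ⟨f, a, v, u, rfl⟩)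
    · have : topPairing ℳ₁ ℳ₂ ℳ₃ h₁ h₂ h₃ I (ℳ₁.leftStar a v) u =
          ℳ₃.topAction a (topPairing ℳ₁ ℳ₂ ℳ₃ h₁ h₂ h₃ I v u) := by
        ext
        rw [hI.coe_topPairing hM₁ hM₂ hM₃, hI.zeroMode_leftStar hM₁ hM₂ hM₃ a v u.2,
          NGradedModule.topAction, LinearMap.coe_restrict_apply, hI.coe_topPairing hM₁ hM₂ hM₃]
      simp [this]
    · have : topPairing ℳ₁ ℳ₂ ℳ₃ h₁ h₂ h₃ I (ℳ₁.rightStar a v) u =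
          topPairing ℳ₁ ℳ₂ ℳ₃ h₁ h₂ h₃ I v (ℳ₂.topAction a u) := by
        ext
        rw [hI.coe_topPairing hM₁ hM₂ hM₃, hI.zeroMode_rightStar hM₁ hM₂ hM₃ a v u.2,
          hI.coe_topPairing hM₁ hM₂ hM₃, NGradedModule.topAction, LinearMap.coe_restrict_apply]
      simp [this]

theorem contractionFunctional_tmul (hM₁ : ℳ₁.HasLowestWeight h₁) (hM₂ : ℳ₂.HasLowestWeight h₂)
    (hM₃ : ℳ₃.HasLowestWeight h₃)
    (hI : IsIntertwining ℳ₁.toWeakModule ℳ₂.toWeakModule ℳ₃.toWeakModule I)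
    (f : Module.Dual ℂ (ℳ₃.gr 0)) (v : M₁) (u : ℳ₂.gr 0) :
    hI.contractionFunctional hM₁ hM₂ hM₃ (Contraction.tmul ℳ₁ ℳ₂ ℳ₃ f v u) =
      f (topPairing ℳ₁ ℳ₂ ℳ₃ h₁ h₂ h₃ I v u) := rfl

end IsIntertwining

theorem Contraction.hom_ext {φ ψ : Module.Dual ℂ (Contraction ℳ₁ ℳ₂ ℳ₃)}
    (h : ∀ f v u, φ (Contraction.tmul ℳ₁ ℳ₂ ℳ₃ f v u) = ψ (Contraction.tmul ℳ₁ ℳ₂ ℳ₃ f v u)) :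
    φ = ψ := by
  refine Submodule.linearMap_qext _ (TensorProduct.ext ?_)
  ext f : 1
  refine TensorProduct.ext (Submodule.linearMap_qext _ ?_)
  ext v u
  exact h f v u

variable (ℳ₂ ℳ₃) in
/-- The map `π` from intertwining operators to functionals on the contraction. -/
def toContractionDual (hM₁ : ℳ₁.HasLowestWeight h₁) (hM₂ : ℳ₂.HasLowestWeight h₂)
    (hM₃ : ℳ₃.HasLowestWeight h₃) :
    intertwiningOperators ℳ₁.toWeakModule ℳ₂.toWeakModule ℳ₃.toWeakModule →ₗ[ℂ]
      Module.Dual ℂ (Contraction ℳ₁ ℳ₂ ℳ₃) where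
  toFun I := IsIntertwining.contractionFunctional hM₁ hM₂ hM₃ I.2
  map_add' I J := Contraction.hom_ext fun f v u => by
    simp only [LinearMap.add_apply, IsIntertwining.contractionFunctional_tmul _ _ _ (I + J).2,
      IsIntertwining.contractionFunctional_tmul _ _ _ I.2,
      IsIntertwining.contractionFunctional_tmul _ _ _ J.2, Submodule.coe_add, map_add]
  map_smul' c I := Contraction.hom_ext fun f v u => by
    simp only [LinearMap.smul_apply, IsIntertwining.contractionFunctional_tmul _ _ _ (c • I).2,
      IsIntertwining.contractionFunctional_tmul _ _ _ I.2, Submodule.coe_smul, map_smul,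
      RingHom.id_apply]

theorem toContractionDual_tmul (hM₁ : ℳ₁.HasLowestWeight h₁) (hM₂ : ℳ₂.HasLowestWeight h₂)
    (hM₃ : ℳ₃.HasLowestWeight h₃)
    (I : intertwiningOperators ℳ₁.toWeakModule ℳ₂.toWeakModule ℳ₃.toWeakModule)
    (f : Module.Dual ℂ (ℳ₃.gr 0)) (v : M₁) (u : ℳ₂.gr 0) :
    toContractionDual ℳ₂ ℳ₃ hM₁ hM₂ hM₃ I (Contraction.tmul ℳ₁ ℳ₂ ℳ₃ f v u) =
      f (topPairing ℳ₁ ℳ₂ ℳ₃ h₁ h₂ h₃ I v u) :=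
  IsIntertwining.contractionFunctional_tmul hM₁ hM₂ hM₃ I.2 f v u

theorem toContractionDual_injective (hM₁ : ℳ₁.HasLowestWeight h₁)
    (hM₂ : ℳ₂.HasLowestWeight h₂) (hM₃ : ℳ₃.HasLowestWeight h₃) (htop₂ : ℳ₂.gr 0 ≠ ⊥)
    (htop₃ : ℳ₃.gr 0 ≠ ⊥) (hirr₂ : ℳ₂.IsIrreducible) (hirr₃ : ℳ₃.IsIrreducible) :
    Function.Injective (toContractionDual ℳ₂ ℳ₃ hM₁ hM₂ hM₃) := by
  refine (injective_iff_map_eq_zero _).mpr fun I hI => Subtype.ext ?_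
  refine IsIntertwining.eq_zero_of_zeroMode_eq_zero hM₁ hM₂ hM₃ htop₂ htop₃ hirr₂ hirr₃ I.2
    fun v u hu => ?_
  -- Functionals separate the points of `M³₀`, so it suffices that `⟨f, o(v)u⟩ = 0` for all `f`.
  rw [← IsIntertwining.coe_topPairing hM₁ hM₂ hM₃ I.2 v ⟨u, hu⟩, Submodule.coe_eq_zero,
    ← Module.forall_dual_apply_eq_zero_iff ℂ]
  intro f
  rw [← toContractionDual_tmul hM₁ hM₂ hM₃, hI, LinearMap.zero_apply]

end Intertwining

theorem proposition3p12 {V M₁ M₂ M₃ : Type*} [AddCommGroup V] [Module ℂ V]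
    [AddCommGroup M₁] [Module ℂ M₁] [AddCommGroup M₂] [Module ℂ M₂] [AddCommGroup M₃] [Module ℂ M₃]
    (𝒱 : VertexOperatorAlgebra V)
    (ℳ₁ : NGradedModule 𝒱 M₁) (ℳ₂ : NGradedModule 𝒱 M₂) (ℳ₃ : NGradedModule 𝒱 M₃)
    (h₁ h₂ h₃ : ℂ)
    (hM₁ : ℳ₁.HasLowestWeight h₁) (hM₂ : ℳ₂.HasLowestWeight h₂) (hM₃ : ℳ₃.HasLowestWeight h₃)
    (htop₂ : ℳ₂.gr 0 ≠ ⊥) (htop₃ : ℳ₃.gr 0 ≠ ⊥)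
    (hirr₂ : ℳ₂.IsIrreducible) (hirr₃ : ℳ₃.IsIrreducible) (hord₃ : ℳ₃.IsOrdinary) :
    (∃ π : intertwiningOperators ℳ₁.toWeakModule ℳ₂.toWeakModule ℳ₃.toWeakModule →ₗ[ℂ]
        Module.Dual ℂ (Contraction ℳ₁ ℳ₂ ℳ₃),
      (∀ (I : intertwiningOperators ℳ₁.toWeakModule ℳ₂.toWeakModule ℳ₃.toWeakModule)
        (f : Module.Dual ℂ (ℳ₃.gr 0)) (v : M₁) (u : ℳ₂.gr 0),
        intertwiningZeroMode ℳ₁ h₁ h₂ h₃ I.1 v u ∈ ℳ₃.gr 0 ∧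
        π I (Contraction.tmul ℳ₁ ℳ₂ ℳ₃ f v u) =
          f (homogeneousProj ℳ₃.isInternal 0 (intertwiningZeroMode ℳ₁ h₁ h₂ h₃ I.1 v u))) ∧
      Function.Injective π) ∧
    Module.rank ℂ (intertwiningOperators ℳ₁.toWeakModule ℳ₂.toWeakModule ℳ₃.toWeakModule) ≤
      Module.rank ℂ (Module.Dual ℂ (Contraction ℳ₁ ℳ₂ ℳ₃)) := by

  have hinj := toContractionDual_injective hM₁ hM₂ hM₃ htop₂ htop₃ hirr₂ hirr₃
  exact ⟨⟨toContractionDual ℳ₂ ℳ₃ hM₁ hM₂ hM₃, fun I f v u =>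
    ⟨IsIntertwining.zeroMode_mem hM₁ hM₂ hM₃ I.2 v u.2,
      toContractionDual_tmul hM₁ hM₂ hM₃ I f v u⟩, hinj⟩, LinearMap.rank_le_of_injective _ hinj⟩
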